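/- A configuration is a locally finite set $\phi\subset\mathbb{R}^2$; the space of configurations carries the $\sigma$-algebra generated by the counts $\phi\mapsto\#(\phi\cap A)$, $A$ Borel. For distinct atoms $x,y\in\phi$, say that $y$ is a nearest neighbor of $x$ if $\|x-y\|\le\|x-z\|$ for all $z\in\phi\setminus\{x\}$; $x$ and $y$ are mutually nearest neighbors if each is a nearest neighbor of the other. An atom $x\in\phi$ is paired if it is a mutually nearest neighbor of some other atom of $\phi$, and single otherwise. Let $\Phi$ be a homogeneous Poisson point process on $\mathbb{R}^2$ with density $\lambda\in(0,\infty)$, let $\Phi^{(1)}$ be the set of single atoms of $\Phi$ and $\Phi^{(2)}$ the set of paired atoms of $\Phi$, and put $$\gamma=\frac23-\frac{\sqrt3}{2\pi},\qquad \delta=\frac1{2-\gamma}.$$ Then $\Phi^{(1)}$ and $\Phi^{(2)}$ are point processes (measurable random configurations), and their intensity measures $M^{(i)}(A)=\mathbb{E}\big[\#(\Phi^{(i)}\cap A)\big]$, $A\subset\mathbb{R}^2$ Borel, are $$M^{(1)}(dx)=(1-\delta)\lambda\,dx,\qquad M^{(2)}(dx)=\delta\lambda\,dx,$$ where $dx$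 denotes Lebesgue measure on $\mathbb{R}^2$. -/

import Mathlib

open MeasureTheory ProbabilityTheory
open scoped NNReal ENNReal

noncomputable section

namespace MNN

/-- The Euclidean plane. -/
abbrev Plane : Type := EuclideanSpace ℝ (Fin 2)

/-- A simple, locally finite configuration of points of the plane. -/
@[ext] structure Configuration where
  /-- The set of atoms. -/
  atoms : Set Plane
  /-- Every compact set contains finitely many atoms. -/
  finite_inter_compact : ∀ K : Set Plane, IsCompact K → (atoms ∩ K).Finite

namespace Configuration

/-- The number of atoms in `A`. -/
def count (φ : Configuration) (A : Set Plane) : ℕ∞ := (φ.atoms ∩ A).encard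

/-- The sigma-algebra on configurations generated by the counts of Borel sets. -/
instance : MeasurableSpace Configuration :=
  ⨆ (A : Set Plane) (_ : MeasurableSet A),
    MeasurableSpace.comap (fun φ : Configuration => φ.count A) inferInstance

/-- The thinning of a configuration by a property of its atoms. -/
def filter (φ : Configuration) (p : Plane → Prop) : Configuration where
  atoms := {x | x ∈ φ.atoms ∧ p x}
  finite_inter_compact K hK :=
    (φ.finite_inter_compact K hK).subset (fun _ hx => ⟨hx.1.1, hx.2⟩)

/-- Nearest neighbour relation: the atom `y ≠ x` minimises the distance to the atom `x` among all
the other atoms. -/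
def NNR (φ : Configuration) (x y : Plane) : Prop :=
  x ∈ φ.atoms ∧ y ∈ φ.atoms \ {x} ∧ ∀ z ∈ φ.atoms \ {x}, dist x y ≤ dist x z

/-- Mutually nearest neighbour relation. -/
def MNNR (φ : Configuration) (x y : Plane) : Prop := φ.NNR x y ∧ φ.NNR y x

/-- `x` cooperates with some other atom. -/
def IsPaired (φ : Configuration) (x : Plane) : Prop := ∃ y ∈ φ.atoms, φ.MNNR x y

/-- `x` cooperates with no other atom. -/
def IsSingle (φ : Configuration) (x : Plane) : Prop := ∀ y ∈ φ.atoms, ¬ φ.MNNR x y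

/-- The atoms that are single. -/
def singles (φ : Configuration) : Configuration := φ.filter φ.IsSingle

/-- The atoms that cooperate with another atom. -/
def pairs (φ : Configuration) : Configuration := φ.filter φ.IsPaired

/-- The counting measure of a configuration, the sum of the unit masses at its atoms. -/
def toMeasure (φ : Configuration) : Measure Plane := Measure.count.restrict φ.atoms

theorem measurable_count {A : Set Plane} (hA : MeasurableSet A) :
    Measurable (fun φ : Configuration => φ.count A) :=
  Measurable.of_comap_le (le_iSup₂_of_le A hA le_rfl)

theorem countable_atoms (φ : Configuration) : φ.atoms.Countable := by
  have h : φ.atoms = ⋃ n : ℕ, φ.atoms ∩ Metric.closedBall (0 : Plane) n := by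
    rw [← Set.inter_iUnion, Metric.iUnion_closedBall_nat, Set.inter_univ]
  rw [h]
  exact Set.countable_iUnion fun n =>
    (φ.finite_inter_compact _ (isCompact_closedBall _ _)).countable

theorem toMeasure_apply (φ : Configuration) {A : Set Plane} (hA : MeasurableSet A) :
    φ.toMeasure A = (φ.count A : ℝ≥0∞) := by
  rw [toMeasure, Measure.restrict_apply hA,
    Measure.count_apply (hA.inter φ.countable_atoms.measurableSet), Set.inter_comm, count]

theorem measurable_toMeasure : Measurable toMeasure := by
  refine Measure.measurable_of_measurable_coe _ fun A hA => ?_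
  simp_rw [toMeasure_apply _ hA]
  exact (Measurable.of_discrete (f := fun n : ℕ∞ => (n : ℝ≥0∞))).comp (measurable_count hA)

end Configuration

variable {Ω : Type*} [MeasurableSpace Ω]

/-- `Φ` is a homogeneous Poisson point process in the plane with density `lam`: it is a random
configuration, the number of its atoms in a bounded Borel set `A` is Poisson distributed with mean
`lam` times the area of `A`, and its numbers of atoms in finitely many pairwise disjoint bounded
Borel sets are independent. -/
structure IsPoissonPointProcess (Φ : Ω → Configuration) (lam : ℝ≥0) (P : Measure Ω) : Prop where
  measurable : Measurable Φ
  map_count : ∀ A : Set Plane, MeasurableSet A → Bornology.IsBounded A →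
    P.map (fun ω => (Φ ω).count A) =
      (poissonMeasure (lam * (volume A).toNNReal)).map (fun n : ℕ => (n : ℕ∞))
  indep_count : ∀ (n : ℕ) (A : Fin n → Set Plane), (∀ i, MeasurableSet (A i)) →
    (∀ i, Bornology.IsBounded (A i)) → Pairwise (Function.onFun Disjoint A) →
    iIndepFun (fun (i : Fin n) (ω : Ω) => (Φ ω).count (A i)) P

/-- The intensity measure `A ↦ 𝔼 [number of atoms of Φ in A]` of a point process. -/
def intensityMeasure (Φ : Ω → Configuration) (P : Measure Ω) : Measure Plane :=
  P.bind (fun ω => (Φ ω).toMeasure)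

theorem intensityMeasure_apply {Φ : Ω → Configuration} (hΦ : Measurable Φ) (P : Measure Ω)
    {A : Set Plane} (hA : MeasurableSet A) :
    intensityMeasure Φ P A = ∫⁻ ω, ((Φ ω).count A : ℝ≥0∞) ∂P := by
  have h : Measurable (fun ω => (Φ ω).toMeasure) := Configuration.measurable_toMeasure.comp hΦ
  rw [intensityMeasure, Measure.bind_apply hA h.aemeasurable]
  simp_rw [Configuration.toMeasure_apply _ hA]

/-- The area, divided by `π`, of the intersection of two unit discs each of whose centres lies on
the boundary circle of the other. -/
def gam : ℝ := 2 / 3 - √3 / (2 * Real.pi)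

/-- The average proportion of atoms in cooperating pairs. -/
def del : ℝ := 1 / (2 - gam)

end MNN

end

/-! Two atoms at distance r are mutually nearest exactly when no third atom lies in the union of the
two open discs of radius r around them. Each disc has its centre on the other circle, so the union
has area (2 - γ)πr², where γπ is the area of the unit lens (`volume_union_ball`). Heuristically, the
expected number of paired atoms in A is λ² ∫_A ∫ exp(-λ(2 - γ)π|x - y|²) dy dx. The inner integral
is Gaussian, equal to 1/(λ(2 - γ)), and the result is δλ|A|.

The double integral is reached by discretisation, using only the void probabilities and independence
of counts. The plane is cut into cells of radius ε. For cells i ≠ j, shrunken discs around the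
centres (`innerRegion`) bound the number of paired atoms from above, and enlarged discs
(`outerRegion`) bound it from below. The counts involved live on disjoint sets, so expectations
factor (`lintegral_separated_pairs_le`, `le_lintegral_pairs`). Both bounds tend to the Gaussian
integral as ε → 0 (`lintegral_pairs`). The singles follow by subtraction from the total intensity λ.
-/

namespace MNN.Configuration

/-! ### Measurability of the singles and the pairs -/

theorem measurable_of_measurable_toMeasure {α : Type*} [MeasurableSpace α] {f : α → Configuration}
    (hf : ∀ A, MeasurableSet A → Measurable fun a => (f a).toMeasure A) : Measurable f := by
  rw [measurable_iff_comap_le]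
  simp_rw [instMeasurableSpace, MeasurableSpace.comap_iSup, MeasurableSpace.comap_comp]
  refine iSup₂_le fun A hA => ?_
  rw [← measurable_iff_comap_le]
  refine measurable_to_countable' fun k => ?_
  have h : ((fun φ : Configuration => φ.count A) ∘ f) ⁻¹' {k} =
      (fun a => (f a).toMeasure A) ⁻¹' {(k : ℝ≥0∞)} := by
    ext a
    simp [toMeasure_apply _ hA]
  rw [h]
  exact hf A hA (measurableSet_singleton _)

/-- Sections of a measurable set have measurable mass under a measurable random configuration. -/
theorem measurable_toMeasure_section {α : Type*} [MeasurableSpace α] {g : α → Configuration}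
    (hg : Measurable g) {S : Set (α × Plane)} (hS : MeasurableSet S) :
    Measurable fun a => (g a).toMeasure (Prod.mk a ⁻¹' S) := by
  have hmono : Monotone fun m : ℕ => Metric.closedBall (0 : Plane) m :=
    fun m n h => Metric.closedBall_subset_closedBall (by exact_mod_cast h)
  -- Configurations may be infinite. Restricting to balls gives finite kernels, whose sections have
  -- measurable mass.
  have key : ∀ a, (g a).toMeasure (Prod.mk a ⁻¹' S) =
      ⨆ m : ℕ, (g a).toMeasure (Prod.mk a ⁻¹' S ∩ Metric.closedBall (0 : Plane) m) := by
    intro a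
    rw [← Monotone.measure_iUnion, ← Set.inter_iUnion, Metric.iUnion_closedBall_nat,
      Set.inter_univ]
    exact fun m n h => Set.inter_subset_inter_right _ (hmono h)
  simp_rw [key]
  refine Measurable.iSup fun m => ?_
  let κ : Kernel α Plane :=
    ⟨fun a => (g a).toMeasure.restrict (Metric.closedBall (0 : Plane) m), by
      refine Measure.measurable_of_measurable_coe _ fun A hA => ?_
      simp_rw [Measure.restrict_apply hA]
      exact (Measure.measurable_coe (hA.inter Metric.isClosed_closedBall.measurableSet)).comp
        (measurable_toMeasure.comp hg)⟩
  have hκ : ∀ a, IsFiniteMeasure (κ a) := by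
    intro a
    refine ⟨?_⟩
    change (g a).toMeasure.restrict (Metric.closedBall (0 : Plane) m) Set.univ < ∞
    rw [Measure.restrict_apply_univ,
      toMeasure_apply _ Metric.isClosed_closedBall.measurableSet, count]
    have := (g a).finite_inter_compact _ (isCompact_closedBall (0 : Plane) m)
    simpa [lt_top_iff_ne_top] using this
  convert! Kernel.measurable_kernel_prodMk_left_of_finite hS hκ using 2 with a
  exact (Measure.restrict_apply (measurable_prodMk_left hS)).symm

theorem toMeasure_eq_count (φ : Configuration) (A : Set Plane) :
    φ.toMeasure A = Measure.count (A ∩ φ.atoms) := by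
  rw [toMeasure, Measure.restrict_apply' φ.countable_atoms.measurableSet]

theorem toMeasure_filter (φ : Configuration) (p : Plane → Prop) (A : Set Plane) :
    (φ.filter p).toMeasure A = φ.toMeasure (A ∩ {x | p x}) := by
  rw [toMeasure_eq_count, toMeasure_eq_count]
  congr 1
  ext x
  simp only [filter, Set.mem_inter_iff, Set.mem_ofPred_eq]
  tauto

theorem toMeasure_eq_zero_iff (φ : Configuration) (A : Set Plane) :
    φ.toMeasure A = 0 ↔ ∀ x ∈ φ.atoms, x ∉ A := by
  rw [toMeasure_eq_count, Measure.count_eq_zero_iff, Set.eq_empty_iff_forall_notMem]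
  simp only [Set.mem_inter_iff]
  exact forall_congr' fun x => by tauto

/-- The set of the positions of atoms that prevent `x` and `y` from being mutually nearest
neighbours. -/
def blockers (x y : Plane) : Set Plane :=
  {z | (z ≠ x ∧ z ≠ y) ∧ (dist x z < dist x y ∨ dist y z < dist x y)}

/-- Turns the minimality conditions into the vanishing of one count, the form in which measurability
and void probabilities apply. -/
theorem mnnr_iff {φ : Configuration} {x y : Plane} :
    φ.MNNR x y ↔ x ∈ φ.atoms ∧ y ∈ φ.atoms ∧ y ≠ x ∧ φ.toMeasure (blockers x y) = 0 := by
  rw [toMeasure_eq_zero_iff]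
  constructor
  · rintro ⟨⟨hx, ⟨hy, hyx⟩, h1⟩, -, -, h2⟩
    refine ⟨hx, hy, hyx, fun z hz hzb => ?_⟩
    rcases hzb with ⟨⟨hzx, hzy⟩, h | h⟩
    · exact absurd (h1 z ⟨hz, hzx⟩) (not_le.2 h)
    · exact absurd (h2 z ⟨hz, hzy⟩) (not_le.2 (by rwa [dist_comm y x]))
  · rintro ⟨hx, hy, hyx, h⟩
    refine ⟨⟨hx, ⟨hy, hyx⟩, fun z hz => ?_⟩, hy, ⟨hx, Ne.symm hyx⟩, fun z hz => ?_⟩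
    · by_contra! hlt
      exact h z hz.1 ⟨⟨hz.2, fun e => by simp [e] at hlt⟩, Or.inl hlt⟩
    · by_contra! hlt
      rw [dist_comm y x] at hlt
      refine h z hz.1 ⟨⟨fun e => ?_, hz.2⟩, Or.inr hlt⟩
      rw [e, dist_comm] at hlt
      exact lt_irrefl _ hlt

/-- Agreement of `S` and `p` at atoms suffices, because the counting measure sees nothing else. -/
theorem measurable_filter {p : Configuration → Plane → Prop} {S : Set (Configuration × Plane)}
    (hS : MeasurableSet S) (hp : ∀ (φ : Configuration), ∀ x ∈ φ.atoms, (φ, x) ∈ S ↔ p φ x) :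
    Measurable fun φ : Configuration => φ.filter (p φ) := by
  refine measurable_of_measurable_toMeasure fun A hA => ?_
  convert! measurable_toMeasure_section measurable_id
    (S := (Set.univ ×ˢ A) ∩ S) ((MeasurableSet.univ.prod hA).inter hS) using 2 with φ
  rw [toMeasure_filter, toMeasure_eq_count, toMeasure_eq_count]
  congr 1
  ext x
  have := hp φ x
  simp only [Set.mem_inter_iff, Set.mem_ofPred_eq, Set.mem_preimage, Set.mem_prod, Set.mem_univ,
    true_and, id]
  tauto

/-- A quantifier over atoms is the vanishing or non-vanishing of a count of a section.
`measurable_toMeasure_section` is used twice: for "no blocker z" and for "some partner y". -/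
theorem exists_measurableSet_isPaired :
    ∃ S : Set (Configuration × Plane), MeasurableSet S ∧
      ∀ (φ : Configuration), ∀ x ∈ φ.atoms, (φ, x) ∈ S ↔ φ.IsPaired x := by
  let B : Set (((Configuration × Plane) × Plane) × Plane) :=
    {q | q.2 ∈ blockers q.1.1.2 q.1.2}
  have hB : MeasurableSet B := by
    have hx : Measurable fun q : ((Configuration × Plane) × Plane) × Plane => q.1.1.2 := by
      fun_prop
    have hy : Measurable fun q : ((Configuration × Plane) × Plane) × Plane => q.1.2 := by
      fun_prop
    have hz : Measurable fun q : ((Configuration × Plane) × Plane) × Plane => q.2 := by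
      fun_prop
    exact ((measurableSet_eq_fun hz hx).compl.inter (measurableSet_eq_fun hz hy).compl).inter
      ((measurableSet_lt (hx.dist hz) (hx.dist hy)).union
        (measurableSet_lt (hy.dist hz) (hx.dist hy)))
  have hN := measurable_toMeasure_section
    (g := fun q : (Configuration × Plane) × Plane => q.1.1) (by fun_prop) hB
  let T : Set ((Configuration × Plane) × Plane) :=
    {q | q.2 ≠ q.1.2} ∩ {q | q.1.1.toMeasure (Prod.mk q ⁻¹' B) = 0}
  have hT : MeasurableSet T :=
    (measurableSet_eq_fun (by fun_prop) (by fun_prop)).compl.inter (hN (measurableSet_singleton 0))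
  have hR := measurable_toMeasure_section (g := fun q : Configuration × Plane => q.1)
    (by fun_prop) hT
  refine ⟨{q | q.1.toMeasure (Prod.mk q ⁻¹' T) = 0}ᶜ, (hR (measurableSet_singleton 0)).compl, ?_⟩
  intro φ x hx
  have hT' : ∀ y, ((φ, x), y) ∈ T ↔ y ≠ x ∧ φ.toMeasure (blockers x y) = 0 := fun y => Iff.rfl
  rw [Set.mem_compl_iff, Set.mem_ofPred_eq, toMeasure_eq_zero_iff, IsPaired]
  push Not
  refine exists_congr fun y => and_congr_right fun hy => ?_
  rw [Set.mem_preimage, hT', mnnr_iff]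
  tauto

theorem isSingle_iff {φ : Configuration} {x : Plane} : φ.IsSingle x ↔ ¬ φ.IsPaired x := by
  simp [IsSingle, IsPaired]

theorem measurable_pairs : Measurable pairs := by
  obtain ⟨S, hS, h⟩ := exists_measurableSet_isPaired
  exact measurable_filter hS h

theorem measurable_singles : Measurable singles := by
  obtain ⟨S, hS, h⟩ := exists_measurableSet_isPaired
  refine measurable_filter hS.compl fun φ x hx => ?_
  rw [Set.mem_compl_iff, h φ x hx, isSingle_iff]

theorem toMeasure_singles_add_pairs (φ : Configuration) {A : Set Plane} (hA : MeasurableSet A) :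
    φ.singles.toMeasure A + φ.pairs.toMeasure A = φ.toMeasure A := by
  have h : MeasurableSet (φ.atoms ∩ {x | φ.IsPaired x}) :=
    (φ.countable_atoms.mono Set.inter_subset_left).measurableSet
  rw [singles, pairs, toMeasure_filter, toMeasure_filter, toMeasure_eq_count, toMeasure_eq_count,
    toMeasure_eq_count, ← measure_union]
  · congr 1
    ext x
    simp only [isSingle_iff, Set.mem_union, Set.mem_inter_iff, Set.mem_ofPred_eq]
    tauto
  · refine Set.disjoint_left.2 fun x hx hx' => ?_
    exact isSingle_iff.1 hx.1.2 hx'.1.2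
  · convert! hA.inter h using 1
    ext x
    simp only [Set.mem_inter_iff, Set.mem_ofPred_eq]
    tauto

end MNN.Configuration

/-! ### Areas of intersections and unions of discs -/

namespace MNN

open Real in
-- A quarter of the lens: the line x = 1/2 and the first axis cut it into four congruent pieces.
theorem integral_half_one_sqrt_one_sub_sq :
    ∫ x in (1 / 2 : ℝ)..1, √(1 - x ^ 2) = gam * π / 4 := by
  have hcont : Continuous fun x : ℝ => (arcsin x + x * √(1 - x ^ 2)) / 2 := by
    have := continuous_arcsin
    fun_prop
  have hderiv : ∀ x ∈ Set.Ioo (1 / 2 : ℝ) 1,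
      HasDerivAt (fun x : ℝ => (arcsin x + x * √(1 - x ^ 2)) / 2) (√(1 - x ^ 2)) x := by
    rintro x ⟨h1, h2⟩
    have hpos : 0 < 1 - x ^ 2 := by nlinarith
    have hs : √(1 - x ^ 2) ≠ 0 := (sqrt_pos.2 hpos).ne'
    have hsq : √(1 - x ^ 2) ^ 2 = 1 - x ^ 2 := sq_sqrt hpos.le
    have ha := hasDerivAt_arcsin (x := x) (by linarith) (by linarith)
    have hb : HasDerivAt (fun x : ℝ => 1 - x ^ 2) (-(2 * x)) x := by
      simpa using (hasDerivAt_pow 2 x).const_sub 1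
    convert! (ha.add ((hasDerivAt_id x).mul (hb.sqrt hpos.ne'))).div_const 2 using 1
    simp only [id]
    field_simp
    rw [hsq]
    ring
  rw [intervalIntegral.integral_eq_sub_of_hasDerivAt_of_le (by norm_num) hcont.continuousOn hderiv
    (Continuous.intervalIntegrable (by fun_prop) _ _)]
  have h1 : arcsin (1 / 2) = π / 6 := by
    rw [← sin_pi_div_six, arcsin_sin] <;> linarith [pi_pos]
  have h2 : √(1 - (1 / 2 : ℝ) ^ 2) = √3 / 2 := by
    rw [show 1 - (1 / 2 : ℝ) ^ 2 = 3 / 2 ^ 2 by norm_num, sqrt_div (by norm_num),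
      sqrt_sq (by norm_num)]
  rw [h1, h2, arcsin_one, gam]
  have := pi_ne_zero
  norm_num
  field_simp
  ring

open Metric Real in
-- Over x in (0, 1) the lens is the set |y| < f(x), and f is invariant under x ↦ 1 - x.
theorem volume_inter_ball_unit :
    volume (ball (0 : Plane) 1 ∩ ball (!₂[1, 0] : Plane) 1) = ENNReal.ofReal (gam * π) := by
  let f : ℝ → ℝ := fun x => min (√(1 - x ^ 2)) (√(1 - (1 - x) ^ 2))
  have hf : Continuous f := by fun_prop
  have hset : (fun v : Plane => MeasurableEquiv.finTwoArrow (α := ℝ) (WithLp.ofLp v)) ⁻¹'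
      (regionBetween (-f) f (Set.Ioo 0 1)) = ball (0 : Plane) 1 ∩ ball (!₂[1, 0] : Plane) 1 := by
    ext v
    have hf0 : ∀ y : ℝ, (-f (v 0) < y ∧ y < f (v 0)) ↔
        y ^ 2 < 1 - v 0 ^ 2 ∧ y ^ 2 < 1 - (1 - v 0) ^ 2 := by
      intro y
      rw [← abs_lt, lt_min_iff, lt_sqrt (abs_nonneg y), lt_sqrt (abs_nonneg y), sq_abs]
    have hl : v ∈ (fun v : Plane => MeasurableEquiv.finTwoArrow (α := ℝ) (WithLp.ofLp v)) ⁻¹'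
      (regionBetween (-f) f (Set.Ioo 0 1)) ↔
        (0 < v 0 ∧ v 0 < 1) ∧ (-f (v 0) < v 1 ∧ v 1 < f (v 0)) := Iff.rfl
    have h1 : ∀ t : ℝ, √t < 1 ↔ t < 1 := fun t => by rw [sqrt_lt' one_pos]; norm_num
    rw [hl, hf0]
    simp only [Set.mem_inter_iff, mem_ball]
    rw [EuclideanSpace.dist_eq, EuclideanSpace.dist_eq, h1, h1]
    simp [Real.dist_eq, Fin.sum_univ_two, sq_abs]
    constructor
    · rintro ⟨-, h2, h3⟩
      constructor <;> nlinarith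
    · rintro ⟨h2, h3⟩
      refine ⟨⟨?_, ?_⟩, ?_, ?_⟩ <;> nlinarith [sq_nonneg (v 1)]
  have hmp : MeasurePreserving
      (fun v : Plane => MeasurableEquiv.finTwoArrow (α := ℝ) (WithLp.ofLp v)) :=
    (volume_preserving_finTwoArrow ℝ).comp (PiLp.volume_preserving_ofLp (Fin 2))
  have hfi : IntegrableOn f (Set.Ioo 0 1) :=
    (hf.integrableOn_Icc).mono_set Set.Ioo_subset_Icc_self
  rw [← hset, hmp.measure_preimage
    (measurableSet_regionBetween hf.measurable.neg hf.measurable measurableSet_Ioo).nullMeasurableSet,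
    Measure.volume_eq_prod,
    volume_regionBetween_eq_integral hfi.neg hfi measurableSet_Ioo
      (fun x _ => by
        have : 0 ≤ f x := le_min (sqrt_nonneg _) (sqrt_nonneg _)
        simpa using this)]
  congr 1
  rw [← integral_Ioc_eq_integral_Ioo, ← intervalIntegral.integral_of_le zero_le_one]
  have hc : Continuous (f - -f) := hf.sub hf.neg
  rw [← intervalIntegral.integral_add_adjacent_intervals (b := 1 / 2)
    (hc.intervalIntegrable _ _) (hc.intervalIntegrable _ _)]
  have e1 : ∫ x in (1 / 2 : ℝ)..1, (f - -f) x = gam * π / 2 := by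
    have : ∫ x in (1 / 2 : ℝ)..1, (f - -f) x = ∫ x in (1 / 2 : ℝ)..1, 2 * √(1 - x ^ 2) := by
      refine intervalIntegral.integral_congr fun x hx => ?_
      rw [Set.uIcc_of_le (by norm_num)] at hx
      have : f x = √(1 - x ^ 2) := min_eq_left (sqrt_le_sqrt (by nlinarith [hx.1]))
      simp only [Pi.sub_apply, Pi.neg_apply, this]
      ring
    rw [this, intervalIntegral.integral_const_mul, integral_half_one_sqrt_one_sub_sq]
    ring
  have e2 : ∫ x in (0 : ℝ)..(1 / 2), (f - -f) x = ∫ x in (1 / 2 : ℝ)..1, (f - -f) x := by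
    have := intervalIntegral.integral_comp_sub_left (a := (0 : ℝ)) (b := 1 / 2) (f - -f) 1
    rw [show (1 : ℝ) - 1 / 2 = 1 / 2 by norm_num, sub_zero] at this
    rw [← this]
    refine intervalIntegral.integral_congr fun x _ => ?_
    have : f (1 - x) = f x := by
      simp only [f, sub_sub_cancel, min_comm]
    simp only [Pi.sub_apply, Pi.neg_apply, this]
  rw [e2, e1]
  ring

theorem gam_nonneg : 0 ≤ gam := by
  rw [gam, sub_nonneg, div_le_div_iff₀ (by positivity) (by norm_num)]
  have := Real.sqrt_le_sqrt (show (3 : ℝ) ≤ 2 ^ 2 by norm_num)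
  rw [Real.sqrt_sq (by norm_num)] at this
  nlinarith [Real.pi_gt_three]

theorem gam_le_one : gam ≤ 1 := by
  have : 0 ≤ √3 / (2 * Real.pi) := by positivity
  rw [gam]
  linarith

open Metric Real Pointwise in
-- A similarity carries the unit lens here: a reflection sending the first basis vector to (b -
-- a)/r, then scaling by r and translation by a.
theorem volume_inter_ball {a b : Plane} {r : ℝ} (h : dist a b = r) :
    volume (ball a r ∩ ball b r) = ENNReal.ofReal (gam * π * r ^ 2) := by
  rcases (h ▸ dist_nonneg : 0 ≤ r).eq_or_lt with rfl | hr
  · simp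
  obtain ⟨R, hR⟩ : ∃ R : Plane ≃ₗᵢ[ℝ] Plane, R (!₂[1, 0] : Plane) = r⁻¹ • (b - a) := by
    refine ⟨_, Submodule.reflection_sub ?_⟩
    rw [norm_smul, ← dist_eq_norm, dist_comm, h, norm_inv, norm_eq_abs, abs_of_pos hr,
      inv_mul_cancel₀ hr.ne']
    simp [EuclideanSpace.norm_eq]
  have hset : ball a r ∩ ball b r = (fun x => x + (-a)) ⁻¹' 
      (r • (R.symm ⁻¹' (ball (0 : Plane) 1 ∩ ball (!₂[1, 0] : Plane) 1))) := by
    ext x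
    have hb : b - a = r • R (!₂[1, 0] : Plane) := by
      rw [hR, smul_smul, mul_inv_cancel₀ hr.ne', one_smul]
    have e : ∀ z : Plane, dist (R.symm (r⁻¹ • (x + -a))) z < 1 ↔ dist x (a + r • R z) < r := by
      intro z
      rw [← R.dist_map, R.apply_symm_apply]
      have : x - (a + r • R z) = r • (r⁻¹ • (x + -a) - R z) := by
        rw [smul_sub, smul_smul, mul_inv_cancel₀ hr.ne', one_smul]
        abel
      rw [dist_eq_norm x, this, norm_smul, norm_eq_abs, abs_of_pos hr, ← dist_eq_norm]
      exact ⟨fun h => by nlinarith, fun h => by nlinarith⟩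
    rw [Set.mem_preimage, Set.mem_smul_set_iff_inv_smul_mem₀ hr.ne', Set.mem_preimage]
    simp only [Set.mem_inter_iff, mem_ball, e, ← hb]
    simp
  rw [hset, measure_preimage_add_right, Measure.addHaar_smul, R.symm.measurePreserving.measure_preimage
    (measurableSet_ball.inter measurableSet_ball).nullMeasurableSet, volume_inter_ball_unit,
    ← ENNReal.ofReal_mul (by positivity)]
  congr 1
  simp [abs_of_pos hr]
  ring

open Metric Real in
theorem volume_ball_plane (a : Plane) {r : ℝ} (hr : 0 ≤ r) :
    volume (ball a r) = ENNReal.ofReal (π * r ^ 2) := by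
  rw [EuclideanSpace.volume_ball_fin_two, ← ENNReal.ofReal_pow hr,
    ← ENNReal.ofReal_mul (by positivity), mul_comm]

open Metric Real in
theorem volume_union_ball {a b : Plane} {r : ℝ} (h : dist a b = r) :
    volume (ball a r ∪ ball b r) = ENNReal.ofReal ((2 - gam) * π * r ^ 2) := by
  have h1 := measure_union_add_inter (μ := volume) (ball a r) (measurableSet_ball (x := b) (ε := r))
  have hr : 0 ≤ r := h ▸ dist_nonneg
  have h2 : 0 ≤ gam * π * r ^ 2 := by have := gam_nonneg; positivity
  have h3 : 0 ≤ (2 - gam) * π * r ^ 2 := by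
    have : 0 ≤ 2 - gam := by linarith [gam_le_one]
    positivity
  rw [volume_inter_ball h, volume_ball_plane _ hr, volume_ball_plane _ hr,
    ← ENNReal.ofReal_add (by positivity) (by positivity)] at h1
  rw [← ENNReal.add_left_inj (ENNReal.ofReal_ne_top (r := gam * π * r ^ 2)), h1,
    ← ENNReal.ofReal_add h3 h2]
  congr 1
  ring

open Metric Real in
-- Enlarging the radius adds at most two annuli. This transfers the exact area, known when the
-- radius is the distance of the centres, to perturbed radii.
theorem volume_union_ball_le (a b : Plane) {s t : ℝ} (hs : 0 ≤ s) (hst : s ≤ t) :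
    volume (ball a t ∪ ball b t) ≤
      volume (ball a s ∪ ball b s) + ENNReal.ofReal (2 * π * (t ^ 2 - s ^ 2)) := by
  have hd : ∀ z : Plane, volume (ball z t \ ball z s) = ENNReal.ofReal (π * (t ^ 2 - s ^ 2)) := by
    intro z
    rw [measure_sdiff (ball_subset_ball hst) measurableSet_ball.nullMeasurableSet
      measure_ball_lt_top.ne, volume_ball_plane _ hs, volume_ball_plane _ (hs.trans hst),
      ← ENNReal.ofReal_sub _ (by positivity), mul_sub]
  have hnn : 0 ≤ π * (t ^ 2 - s ^ 2) := mul_nonneg pi_pos.le (by nlinarith)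
  calc volume (ball a t ∪ ball b t)
      ≤ volume ((ball a s ∪ ball b s) ∪ ((ball a t \ ball a s) ∪ (ball b t \ ball b s))) := by
        refine measure_mono fun z hz => ?_
        simp only [Set.mem_union, Set.mem_sdiff] at hz ⊢
        tauto
    _ ≤ _ := (measure_union_le _ _).trans (add_le_add_right (measure_union_le _ _) _)
    _ = _ := by
        rw [hd, hd, ← ENNReal.ofReal_add hnn hnn]
        congr 2
        ring

end MNN

/-! ### Poisson counts on disjoint sets -/

namespace MNN

/-- Size biasing: n + 1 times the mass at n + 1 is r times the mass at n. -/
theorem lintegral_id_poissonMeasure (r : ℝ≥0) : ∫⁻ n, (n : ℝ≥0∞) ∂(poissonMeasure r) = r := by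
  rw [lintegral_countable', tsum_eq_zero_add' ENNReal.summable]
  have h1 : HasSum (fun n : ℕ => Real.exp (-r) * r ^ n / n.factorial * r) (1 * r) :=
    (hasSum_one_poissonMeasure r).mul_right _
  have h2 : ∀ n : ℕ, ((n + 1 : ℕ) : ℝ≥0∞) * poissonMeasure r {n + 1} =
      ENNReal.ofReal (Real.exp (-r) * r ^ n / n.factorial * r) := by
    intro n
    rw [poissonMeasure_singleton, ← ENNReal.ofReal_natCast, ← ENNReal.ofReal_mul (by positivity)]
    congr 1
    rw [Nat.factorial_succ, pow_succ]
    push_cast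
    field_simp
  simp_rw [h2]
  rw [← ENNReal.ofReal_tsum_of_nonneg (fun n => by positivity) h1.summable, h1.tsum_eq]
  simp

variable {Ω : Type*} [MeasurableSpace Ω] {Φ : Ω → Configuration} {lam : ℝ≥0} {P : Measure Ω}

namespace IsPoissonPointProcess

theorem lintegral_comp_count (hΦ : IsPoissonPointProcess Φ lam P) {C : Set Plane}
    (hC : MeasurableSet C) (bC : Bornology.IsBounded C) (f : ℕ∞ → ℝ≥0∞) :
    ∫⁻ ω, f ((Φ ω).count C) ∂P =
      ∫⁻ n : ℕ, f n ∂(poissonMeasure (lam * (volume C).toNNReal)) := by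
  have hm : Measurable fun ω => (Φ ω).count C :=
    (Configuration.measurable_count hC).comp hΦ.measurable
  rw [← lintegral_map (f := f) .of_discrete hm, hΦ.map_count C hC bC,
    lintegral_map .of_discrete .of_discrete]

theorem lintegral_comp_count_mul₃ (hΦ : IsPoissonPointProcess Φ lam P) {C D E : Set Plane}
    (hC : MeasurableSet C) (hD : MeasurableSet D) (hE : MeasurableSet E)
    (bC : Bornology.IsBounded C) (bD : Bornology.IsBounded D) (bE : Bornology.IsBounded E)
    (hCD : Disjoint C D) (hCE : Disjoint C E) (hDE : Disjoint D E) (f g h : ℕ∞ → ℝ≥0∞) :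
    ∫⁻ ω, f ((Φ ω).count C) * g ((Φ ω).count D) * h ((Φ ω).count E) ∂P =
      (∫⁻ n : ℕ, f n ∂(poissonMeasure (lam * (volume C).toNNReal))) *
      (∫⁻ n : ℕ, g n ∂(poissonMeasure (lam * (volume D).toNNReal))) *
      (∫⁻ n : ℕ, h n ∂(poissonMeasure (lam * (volume E).toNNReal))) := by
  have hm : ∀ A, MeasurableSet A → Measurable fun ω => (Φ ω).count A :=
    fun A hA => (Configuration.measurable_count hA).comp hΦ.measurable
  have hA : ∀ i, MeasurableSet (![C, D, E] i) := by
    intro i; fin_cases i <;> assumption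
  have key := hΦ.indep_count 3 ![C, D, E] hA (by intro i; fin_cases i <;> assumption) (by
      intro i j hij
      fin_cases i <;> fin_cases j <;>
        first
        | exact absurd rfl hij
        | assumption
        | exact Disjoint.symm ‹_›)
  have key2 := key.comp ![f, g, h] (fun _ => .of_discrete)
  have key3 := lintegral_prod_eq_prod_lintegral_of_indepFun Finset.univ _ key2
    (fun i => (Measurable.of_discrete (f := ![f, g, h] i)).comp (hm _ (hA i)))
  simp only [Fin.prod_univ_three] at key3
  rw [← hΦ.lintegral_comp_count hC bC, ← hΦ.lintegral_comp_count hD bD,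
    ← hΦ.lintegral_comp_count hE bE]
  exact key3

theorem lintegral_toMeasure (hΦ : IsPoissonPointProcess Φ lam P) {C : Set Plane}
    (hC : MeasurableSet C) (bC : Bornology.IsBounded C) :
    ∫⁻ ω, (Φ ω).toMeasure C ∂P = lam * volume C := by
  simp_rw [Configuration.toMeasure_apply _ hC]
  rw [hΦ.lintegral_comp_count hC bC (fun n => (n : ℝ≥0∞))]
  simp only [ENat.toENNReal_coe]
  rw [lintegral_id_poissonMeasure, ENNReal.coe_mul, ENNReal.coe_toNNReal bC.measure_lt_top.ne]

/-- The expected number of pairs of atoms in `C ×ˢ D` on the event that `E` is void. -/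
theorem lintegral_mul_mul_void (hΦ : IsPoissonPointProcess Φ lam P) {C D E : Set Plane}
    (hC : MeasurableSet C) (hD : MeasurableSet D) (hE : MeasurableSet E)
    (bC : Bornology.IsBounded C) (bD : Bornology.IsBounded D) (bE : Bornology.IsBounded E)
    (hCD : Disjoint C D) (hCE : Disjoint C E) (hDE : Disjoint D E) :
    ∫⁻ ω, (Φ ω).toMeasure C * (Φ ω).toMeasure D *
        ({0} : Set ℝ≥0∞).indicator 1 ((Φ ω).toMeasure E) ∂P =
      lam ^ 2 * volume C * volume D * ENNReal.ofReal (Real.exp (-lam * volume.real E)) := by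
  simp_rw [Configuration.toMeasure_apply _ hC, Configuration.toMeasure_apply _ hD,
    Configuration.toMeasure_apply _ hE]
  rw [hΦ.lintegral_comp_count_mul₃ hC hD hE bC bD bE hCD hCE hDE (fun n => (n : ℝ≥0∞))
    (fun n => (n : ℝ≥0∞)) (fun n => ({0} : Set ℝ≥0∞).indicator 1 (n : ℝ≥0∞))]
  simp only [ENat.toENNReal_coe]
  have h0 : (fun n : ℕ => ({0} : Set ℝ≥0∞).indicator (1 : ℝ≥0∞ → ℝ≥0∞) (n : ℝ≥0∞)) =
      ({0} : Set ℕ).indicator 1 := by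
    ext n; simp [Set.indicator]
  rw [h0, lintegral_id_poissonMeasure, lintegral_id_poissonMeasure,
    lintegral_indicator_one (measurableSet_singleton 0), poissonMeasure_singleton]
  simp only [ENNReal.coe_mul, ENNReal.coe_toNNReal bC.measure_lt_top.ne,
    ENNReal.coe_toNNReal bD.measure_lt_top.ne]
  simp [Measure.real, ENNReal.coe_toNNReal_eq_toReal]
  ring

/-- The probability of one atom in `C`, one atom in `D` and no atom in `E`. -/
theorem lintegral_one_one_void (hΦ : IsPoissonPointProcess Φ lam P) {C D E : Set Plane}
    (hC : MeasurableSet C) (hD : MeasurableSet D) (hE : MeasurableSet E)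
    (bC : Bornology.IsBounded C) (bD : Bornology.IsBounded D) (bE : Bornology.IsBounded E)
    (hCD : Disjoint C D) (hCE : Disjoint C E) (hDE : Disjoint D E) :
    ∫⁻ ω, ({1} : Set ℝ≥0∞).indicator 1 ((Φ ω).toMeasure C) *
        ({1} : Set ℝ≥0∞).indicator 1 ((Φ ω).toMeasure D) *
        ({0} : Set ℝ≥0∞).indicator 1 ((Φ ω).toMeasure E) ∂P =
      lam ^ 2 * volume C * volume D *
        ENNReal.ofReal (Real.exp (-lam * volume.real (C ∪ D ∪ E))) := by
  simp_rw [Configuration.toMeasure_apply _ hC, Configuration.toMeasure_apply _ hD,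
    Configuration.toMeasure_apply _ hE]
  rw [hΦ.lintegral_comp_count_mul₃ hC hD hE bC bD bE hCD hCE hDE
    (fun n => ({1} : Set ℝ≥0∞).indicator 1 (n : ℝ≥0∞))
    (fun n => ({1} : Set ℝ≥0∞).indicator 1 (n : ℝ≥0∞))
    (fun n => ({0} : Set ℝ≥0∞).indicator 1 (n : ℝ≥0∞))]
  have h0 : (fun n : ℕ => ({0} : Set ℝ≥0∞).indicator (1 : ℝ≥0∞ → ℝ≥0∞) (n : ℝ≥0∞)) =
      ({0} : Set ℕ).indicator 1 := by
    ext n; simp [Set.indicator]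
  have h1 : (fun n : ℕ => ({1} : Set ℝ≥0∞).indicator (1 : ℝ≥0∞ → ℝ≥0∞) (n : ℝ≥0∞)) =
      ({1} : Set ℕ).indicator 1 := by
    ext n; simp [Set.indicator]
  simp only [ENat.toENNReal_coe, h0, h1]
  have hr : volume.real (C ∪ D ∪ E) = volume.real C + volume.real D + volume.real E := by
    rw [measureReal_union (Set.disjoint_union_left.2 ⟨hCE, hDE⟩) hE
      (bC.union bD).measure_lt_top.ne bE.measure_lt_top.ne,
      measureReal_union hCD hD bC.measure_lt_top.ne bD.measure_lt_top.ne]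
  simp only [lintegral_indicator_one (measurableSet_singleton _), poissonMeasure_singleton]
  have e : ∀ {S : Set Plane}, Bornology.IsBounded S → volume S = ENNReal.ofReal (volume.real S) :=
    fun h => (ENNReal.ofReal_toReal h.measure_lt_top.ne).symm
  rw [e bC, e bD, hr, ← ENNReal.ofReal_coe_nnreal, ← ENNReal.ofReal_pow (by positivity),
    ← ENNReal.ofReal_mul (by positivity), ← ENNReal.ofReal_mul (by positivity),
    ← ENNReal.ofReal_mul (by positivity), ← ENNReal.ofReal_mul (by positivity),
    ← ENNReal.ofReal_mul (by positivity)]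
  congr 1
  simp only [NNReal.coe_mul]
  -- The one-atom probabilities carry exponential factors too, so the exponent is the area of the
  -- whole union.
  rw [mul_add, mul_add, Real.exp_add, Real.exp_add]
  simp [measureReal_def, ENNReal.coe_toNNReal_eq_toReal]
  ring

end IsPoissonPointProcess

end MNN

/-! ### Deterministic cell bounds on the number of paired atoms -/

namespace MNN

open Metric

/-- A union of two discs around `c i` and `c j` that prevents atoms close to `c i` and `c j` from
being mutually nearest neighbours as soon as it contains another atom. -/
def innerRegion (c : ℕ → Plane) (ε : ℝ) (i j : ℕ) : Set Plane :=
  ball (c i) (max 0 (dist (c i) (c j) - 3 * ε)) ∪ ball (c j) (max 0 (dist (c i) (c j) - 3 * ε))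

/-- A union of two discs around `c i` and `c j` that has to contain another atom when atoms close
to `c i` and `c j` are not mutually nearest neighbours. -/
def outerRegion (c : ℕ → Plane) (ε : ℝ) (i j : ℕ) : Set Plane :=
  ball (c i) (dist (c i) (c j) + 3 * ε) ∪ ball (c j) (dist (c i) (c j) + 3 * ε)

namespace Configuration

theorem one_le_toMeasure {φ : Configuration} {x : Plane} {A : Set Plane} (hx : x ∈ φ.atoms)
    (hA : x ∈ A) : 1 ≤ φ.toMeasure A := by
  have h : φ.toMeasure {x} = 1 := by
    rw [toMeasure_eq_count, Set.inter_eq_left.2 (Set.singleton_subset_iff.2 hx),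
      Measure.count_singleton]
  rw [← h]
  exact measure_mono (Set.singleton_subset_iff.2 hA)

theorem exists_eq_singleton_of_toMeasure_eq_one {φ : Configuration} {A : Set Plane}
    (hA : MeasurableSet A) (h : φ.toMeasure A = 1) :
    ∃ x ∈ φ.atoms, x ∈ A ∧ ∀ z ∈ φ.atoms, z ∈ A → z = x := by
  rw [toMeasure_apply _ hA, count, ← ENat.toENNReal_one, ENat.toENNReal_inj,
    Set.encard_eq_one] at h
  obtain ⟨x, hx⟩ := h
  have hx' : x ∈ φ.atoms ∩ A := hx ▸ rfl
  exact ⟨x, hx'.1, hx'.2, fun z hz hzA => by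
    have : z ∈ φ.atoms ∩ A := ⟨hz, hzA⟩
    rwa [hx] at this⟩

variable {q : Plane → ℕ} {c : ℕ → Plane} {ε : ℝ}

/-- The margin 3ε is 2ε for replacing x, y by their centres in the distance, plus ε for moving one
disc centre. Removing both cells excludes x and y themselves. -/
theorem MNNR.toMeasure_innerRegion {φ : Configuration} (hq : ∀ x, dist x (c (q x)) ≤ ε)
    {x y : Plane} (h : φ.MNNR x y) :
    φ.toMeasure (innerRegion c ε (q x) (q y) \ (q ⁻¹' {q x} ∪ q ⁻¹' {q y})) = 0 := by
  have h0 := (mnnr_iff.1 h).2.2.2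
  refine measure_mono_null (fun z hz => ?_) h0
  obtain ⟨hz1, hz2⟩ := hz
  refine ⟨⟨fun e => hz2 (Or.inl (e ▸ rfl)), fun e => hz2 (Or.inr (e ▸ rfl))⟩, ?_⟩
  have hx := hq x
  have hy := hq y
  have hd : dist (c (q x)) (c (q y)) ≤ dist x y + 2 * ε := by
    have := dist_triangle4 (c (q x)) x y (c (q y))
    rw [dist_comm _ x] at this
    linarith
  rcases hz1 with hz1 | hz1
  · left
    have hm := mem_ball.1 hz1
    have := dist_triangle x (c (q x)) z
    rw [dist_comm (c (q x)) z] at this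
    rcases lt_max_iff.1 hm with h' | h'
    · exact absurd dist_nonneg (not_le.2 h')
    · linarith
  · right
    have hm := mem_ball.1 hz1
    have := dist_triangle y (c (q y)) z
    rw [dist_comm (c (q y)) z] at this
    rcases lt_max_iff.1 hm with h' | h'
    · exact absurd dist_nonneg (not_le.2 h')
    · linarith

open Classical in
-- If the part of cell i paired into cell j is nonempty, the void indicator is 1 and cell j has an
-- atom, so the product dominates the number of atoms in that part.
theorem toMeasure_pairs_le_tsum (φ : Configuration) (hq : ∀ x, dist x (c (q x)) ≤ ε)
    (A : Set Plane) :
    φ.toMeasure (A ∩ {x | ∃ y, φ.MNNR x y ∧ q x ≠ q y}) ≤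
      ∑' i, ∑' j, if i = j then 0 else
        φ.toMeasure (q ⁻¹' {i} ∩ A) * φ.toMeasure (q ⁻¹' {j}) *
          ({0} : Set ℝ≥0∞).indicator 1
            (φ.toMeasure (innerRegion c ε i j \ (q ⁻¹' {i} ∪ q ⁻¹' {j}))) := by
  let S : ℕ → ℕ → Set Plane := fun i j =>
    (q ⁻¹' {i} ∩ A) ∩ {x | ∃ y, φ.MNNR x y ∧ i ≠ j ∧ q y = j}
  have hS : A ∩ {x | ∃ y, φ.MNNR x y ∧ q x ≠ q y} ⊆ ⋃ i, ⋃ j, S i j := by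
    rintro x ⟨hx, y, hxy, hne⟩
    exact Set.mem_iUnion.2 ⟨q x, Set.mem_iUnion.2 ⟨q y, ⟨rfl, hx⟩, y, hxy, hne, rfl⟩⟩
  refine (measure_mono hS).trans <| (measure_iUnion_le _).trans <| ENNReal.tsum_le_tsum fun i =>
    (measure_iUnion_le _).trans <| ENNReal.tsum_le_tsum fun j => ?_
  rcases (S i j).eq_empty_or_nonempty with h | ⟨x, ⟨hx1, hx2⟩, y, hxy, hij, hy⟩
  · rw [h, measure_empty]; exact zero_le
  · have hx1 : q x = i := hx1
    have h0 := hxy.toMeasure_innerRegion hq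
    rw [hx1, hy] at h0
    rw [if_neg hij, h0, Set.indicator_of_mem (Set.mem_singleton _), Pi.one_apply, mul_one]
    exact (measure_mono Set.inter_subset_left).trans
      (le_mul_of_one_le_right' (one_le_toMeasure (mnnr_iff.1 hxy).2.1 hy))

theorem mnnr_of_outerRegion {φ : Configuration} {C D : Set Plane} {i j : ℕ} {x y : Plane}
    (hxi : dist x (c i) ≤ ε) (hyj : dist y (c j) ≤ ε) (hx : x ∈ φ.atoms) (hy : y ∈ φ.atoms)
    (hyx : y ≠ x) (hC : ∀ z ∈ φ.atoms, z ∈ C → z = x) (hD : ∀ z ∈ φ.atoms, z ∈ D → z = y)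
    (h0 : φ.toMeasure (outerRegion c ε i j \ (C ∪ D)) = 0) : φ.MNNR x y := by
  refine mnnr_iff.2 ⟨hx, hy, hyx, (toMeasure_eq_zero_iff _ _).2 fun z hz hzb => ?_⟩
  refine (toMeasure_eq_zero_iff _ _).1 h0 z hz ⟨?_, ?_⟩
  · have hd : dist x y ≤ dist (c i) (c j) + 2 * ε := by
      have := dist_triangle4 x (c i) (c j) y
      rw [dist_comm (c j) y] at this
      linarith
    rcases hzb.2 with h | h
    · left
      have := dist_triangle z x (c i)
      rw [dist_comm z x] at this
      exact mem_ball.2 (by linarith)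
    · right
      have := dist_triangle z y (c j)
      rw [dist_comm z y] at this
      exact mem_ball.2 (by linarith)
  · rintro (h | h)
    · exact hzb.1.1 (hC z hz h)
    · exact hzb.1.2 (hD z hz h)

open Classical in
-- For fixed i at most one j contributes, and it produces a paired atom in cell i ∩ A. Hence the sum
-- over j is at most the number of paired atoms there.
theorem tsum_le_toMeasure_pairs (φ : Configuration) (hqm : Measurable q)
    (hq : ∀ x, dist x (c (q x)) ≤ ε) (hε : 0 < ε) {A : Set Plane} (hA : MeasurableSet A) :
    ∑' i, ∑' j, (if i = j then 0 else
        ({1} : Set ℝ≥0∞).indicator 1 (φ.toMeasure (q ⁻¹' {i} ∩ A)) *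
        ({1} : Set ℝ≥0∞).indicator 1 (φ.toMeasure (q ⁻¹' {j})) *
        ({0} : Set ℝ≥0∞).indicator 1
          (φ.toMeasure (outerRegion c ε i j \ ((q ⁻¹' {i} ∩ A) ∪ q ⁻¹' {j})))) ≤
      φ.pairs.toMeasure A := by
  have hQ : ∀ i, MeasurableSet (q ⁻¹' {i}) := fun i => hqm (measurableSet_singleton i)
  have hdec : φ.pairs.toMeasure A = ∑' i, φ.pairs.toMeasure (q ⁻¹' {i} ∩ A) := by
    rw [← measure_iUnion _ fun i => (hQ i).inter hA]
    · rw [← Set.iUnion_inter]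
      congr 1
      ext x
      simp
    · intro i j hij
      refine Set.disjoint_left.2 fun x hx hx' => hij ?_
      exact (Set.mem_singleton_iff.1 hx.1).symm.trans (Set.mem_singleton_iff.1 hx'.1)
  rw [hdec]
  refine ENNReal.tsum_le_tsum fun i => ?_
  let G : ℕ → Prop := fun j => i ≠ j ∧ φ.toMeasure (q ⁻¹' {i} ∩ A) = 1 ∧
    φ.toMeasure (q ⁻¹' {j}) = 1 ∧
    φ.toMeasure (outerRegion c ε i j \ ((q ⁻¹' {i} ∩ A) ∪ q ⁻¹' {j})) = 0
  have hterm : ∀ j, (if i = j then 0 else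
        ({1} : Set ℝ≥0∞).indicator 1 (φ.toMeasure (q ⁻¹' {i} ∩ A)) *
        ({1} : Set ℝ≥0∞).indicator 1 (φ.toMeasure (q ⁻¹' {j})) *
        ({0} : Set ℝ≥0∞).indicator 1
          (φ.toMeasure (outerRegion c ε i j \ ((q ⁻¹' {i} ∩ A) ∪ q ⁻¹' {j})))) =
      if G j then (1 : ℝ≥0∞) else 0 := by
    intro j
    by_cases h1 : i = j <;> by_cases h2 : φ.toMeasure (q ⁻¹' {i} ∩ A) = 1 <;>
      by_cases h3 : φ.toMeasure (q ⁻¹' {j}) = 1 <;>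
      by_cases h4 : φ.toMeasure (outerRegion c ε i j \ ((q ⁻¹' {i} ∩ A) ∪ q ⁻¹' {j})) = 0 <;>
      simp [G, h1, h2, h3, h4]
  simp_rw [hterm]
  by_cases hG : ∃ j, G j
  · obtain ⟨j, hj⟩ := hG
    have huniq : ∀ j', j' ≠ j → ¬ G j' := by
      -- If k and l both contributed, with centre k no farther from centre i, the atom of cell k
      -- would lie in the supposedly void part of the outer region of (i, l).
      have key : ∀ k l, k ≠ l → dist (c i) (c k) ≤ dist (c i) (c l) → G k → ¬ G l := by
        rintro k l hkl hd ⟨hik, -, hk, -⟩ ⟨-, -, -, hl⟩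
        obtain ⟨y, hy, hyk, -⟩ := exists_eq_singleton_of_toMeasure_eq_one (hQ k) hk
        have hyk : q y = k := hyk
        refine (toMeasure_eq_zero_iff _ _).1 hl y hy ⟨Or.inl (mem_ball.2 ?_), ?_⟩
        · have h1 := hq y
          rw [hyk] at h1
          have h2 := dist_triangle y (c k) (c i)
          rw [dist_comm (c k)] at h2
          linarith
        · rintro (h | h)
          · exact hik ((Set.mem_singleton_iff.1 h.1).symm.trans hyk)
          · exact hkl (hyk.symm.trans h)
      intro j' hne hj'
      rcases le_total (dist (c i) (c j)) (dist (c i) (c j')) with h | h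
      · exact key j j' hne.symm h hj hj'
      · exact key j' j hne h hj' hj
    rw [tsum_eq_single j fun j' h => if_neg (huniq j' h), if_pos hj]
    obtain ⟨hij, h1, h2, h3⟩ := hj
    obtain ⟨x, hx, hxC, hx'⟩ := exists_eq_singleton_of_toMeasure_eq_one ((hQ i).inter hA) h1
    obtain ⟨y, hy, hyD, hy'⟩ := exists_eq_singleton_of_toMeasure_eq_one (hQ j) h2
    have hxi : q x = i := hxC.1
    have hyj : q y = j := hyD
    have := mnnr_of_outerRegion (hxi ▸ hq x) (hyj ▸ hq y) hx hy
      (fun e => hij (by rw [← hxi, ← hyj, e])) hx' hy' h3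
    exact one_le_toMeasure (x := x) (φ := φ.pairs) ⟨hx, y, hy, this⟩ hxC
  · push Not at hG
    simp [hG]

end Configuration

end MNN

/-! ### Expectation bounds at a fixed cell size -/

namespace MNN

open Metric Real

theorem preimage_subset_closedBall_of_dist_le {q : Plane → ℕ} {c : ℕ → Plane} {ε : ℝ}
    (hq : ∀ x, dist x (c (q x)) ≤ ε) (i : ℕ) : q ⁻¹' {i} ⊆ closedBall (c i) ε := by
  intro x hx
  have hx : q x = i := hx
  exact hx ▸ hq x

theorem isBounded_innerRegion (c : ℕ → Plane) (ε : ℝ) (i j : ℕ) :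
    Bornology.IsBounded (innerRegion c ε i j) := isBounded_ball.union isBounded_ball

theorem isBounded_outerRegion (c : ℕ → Plane) (ε : ℝ) (i j : ℕ) :
    Bornology.IsBounded (outerRegion c ε i j) := isBounded_ball.union isBounded_ball

/-- The term 12πεd bounds the area of the two annuli lost by shrinking; 2πε² bounds the two removed
cells. -/
theorem le_volume_innerRegion_diff {q : Plane → ℕ} {c : ℕ → Plane} {ε : ℝ} (hε : 0 ≤ ε)
    (hq : ∀ x, dist x (c (q x)) ≤ ε) (i j : ℕ) :
    (2 - gam) * π * dist (c i) (c j) ^ 2 - 12 * π * ε * dist (c i) (c j) - 2 * π * ε ^ 2 ≤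
      volume.real (innerRegion c ε i j \ (q ⁻¹' {i} ∪ q ⁻¹' {j})) := by
  set d := dist (c i) (c j) with hd
  set ρ := max 0 (d - 3 * ε) with hρ
  have hd0 : 0 ≤ d := dist_nonneg
  have hρ0 : 0 ≤ ρ := le_max_left _ _
  have hρd : ρ ≤ d := max_le hd0 (by linarith)
  have hsq : d ^ 2 - ρ ^ 2 ≤ 6 * ε * d := by
    rcases le_total 0 (d - 3 * ε) with h | h
    · rw [hρ, max_eq_right h]; nlinarith
    · rw [hρ, max_eq_left h]; nlinarith
  have hsq0 : 0 ≤ d ^ 2 - ρ ^ 2 := by nlinarith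
  have hκ : 0 ≤ 2 - gam := by linarith [gam_le_one]
  have hball : ∀ i, volume.real (q ⁻¹' {i}) ≤ π * ε ^ 2 := by
    intro i
    refine (measureReal_mono (preimage_subset_closedBall_of_dist_le hq i)
      measure_closedBall_lt_top.ne).trans_eq ?_
    rw [measureReal_def, Measure.addHaar_closedBall_eq_addHaar_ball, volume_ball_plane _ hε,
      ENNReal.toReal_ofReal (by positivity)]
  have h1 : (2 - gam) * π * d ^ 2 ≤ volume.real (innerRegion c ε i j) + 2 * π * (d ^ 2 - ρ ^ 2) := by
    have h := volume_union_ball_le (c i) (c j) hρ0 hρd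
    rw [volume_union_ball hd.symm] at h
    have hfin : volume (ball (c i) ρ ∪ ball (c j) ρ) ≠ ∞ :=
      (isBounded_ball.union isBounded_ball).measure_lt_top.ne
    have h := ENNReal.toReal_mono (by simp [hfin]) h
    rwa [ENNReal.toReal_add hfin ENNReal.ofReal_ne_top, ENNReal.toReal_ofReal (by positivity),
      ENNReal.toReal_ofReal (by positivity)] at h
  have h2 := le_measureReal_sdiff (μ := volume) (s₁ := innerRegion c ε i j)
    (s₂ := q ⁻¹' {i} ∪ q ⁻¹' {j})
    ((isBounded_closedBall.subset (preimage_subset_closedBall_of_dist_le hq i)).union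
      (isBounded_closedBall.subset (preimage_subset_closedBall_of_dist_le hq j))).measure_lt_top.ne
  have h3 := measureReal_union_le (μ := volume) (q ⁻¹' {i}) (q ⁻¹' {j})
  have := hball i
  have := hball j
  nlinarith [pi_pos]

theorem volume_outerRegion_le (c : ℕ → Plane) {ε : ℝ} (hε : 0 ≤ ε) (i j : ℕ) :
    volume.real (outerRegion c ε i j) ≤
      (2 - gam) * π * dist (c i) (c j) ^ 2 + 12 * π * ε * dist (c i) (c j) + 18 * π * ε ^ 2 := by
  set d := dist (c i) (c j) with hd
  have hd0 : 0 ≤ d := dist_nonneg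
  have hκ : 0 ≤ 2 - gam := by linarith [gam_le_one]
  have h := volume_union_ball_le (c i) (c j) hd0 (show d ≤ d + 3 * ε by linarith)
  have hnn : 0 ≤ (d + 3 * ε) ^ 2 - d ^ 2 := by nlinarith
  rw [volume_union_ball hd.symm, ← ENNReal.ofReal_add (by positivity) (by positivity)] at h
  refine (ENNReal.toReal_le_of_le_ofReal (by positivity) h).trans_eq ?_
  ring

/-- Integrals of functions of cell indices as double series. -/
theorem tsum_tsum_mul_volume_eq_lintegral {q : Plane → ℕ} (hqm : Measurable q) {A : Set Plane}
    (g : ℕ → ℕ → ℝ≥0∞) :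
    ∑' i, ∑' j, volume (q ⁻¹' {i} ∩ A) * volume (q ⁻¹' {j}) * g i j =
      ∫⁻ p, g (q p.1) (q p.2) ∂(((volume : Measure Plane).restrict A).prod volume) := by
  have hfib : ∀ (μ : Measure Plane) (h : ℕ → ℝ≥0∞),
      ∫⁻ x, h (q x) ∂μ = ∑' i, h i * μ (q ⁻¹' {i}) := by
    intro μ h
    rw [← lintegral_map (f := h) .of_discrete hqm, lintegral_countable']
    simp_rw [Measure.map_apply hqm (measurableSet_singleton _)]
  have hm : Measurable fun p : Plane × Plane => g (q p.1) (q p.2) :=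
    (Measurable.of_discrete (f := fun n : ℕ × ℕ => g n.1 n.2)).comp
      ((hqm.comp measurable_fst).prodMk (hqm.comp measurable_snd))
  rw [lintegral_prod _ hm.aemeasurable]
  simp_rw [hfib volume]
  rw [hfib _ (fun i => ∑' j, g i j * volume (q ⁻¹' {j}))]
  refine tsum_congr fun i => ?_
  rw [← ENNReal.tsum_mul_right]
  refine tsum_congr fun j => ?_
  rw [Measure.restrict_apply (hqm (measurableSet_singleton i))]
  ring

variable {Ω : Type*} [MeasurableSpace Ω] {Φ : Ω → Configuration} {lam : ℝ≥0} {P : Measure Ω}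

namespace IsPoissonPointProcess

theorem measurable_toMeasure_apply (hΦ : IsPoissonPointProcess Φ lam P) {A : Set Plane}
    (hA : MeasurableSet A) : Measurable fun ω => (Φ ω).toMeasure A :=
  (Measure.measurable_coe hA).comp (Configuration.measurable_toMeasure.comp hΦ.measurable)

/-- The measurable majorant `F` spares any measurability claim about the separated pairs and is what
Fatou's lemma is applied to. -/
theorem lintegral_separated_pairs_le (hΦ : IsPoissonPointProcess Φ lam P) {q : Plane → ℕ}
    {c : ℕ → Plane} {ε : ℝ} (hε : 0 ≤ ε) (hqm : Measurable q) (hq : ∀ x, dist x (c (q x)) ≤ ε)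
    {A : Set Plane} (hA : MeasurableSet A) :
    ∃ F : Ω → ℝ≥0∞, Measurable F ∧
      (∀ ω, (Φ ω).toMeasure (A ∩ {x | ∃ y, (Φ ω).MNNR x y ∧ q x ≠ q y}) ≤ F ω) ∧
      ∫⁻ ω, F ω ∂P ≤ lam ^ 2 * ∫⁻ p, ENNReal.ofReal (exp (-lam *
        ((2 - gam) * π * dist (c (q p.1)) (c (q p.2)) ^ 2 -
          12 * π * ε * dist (c (q p.1)) (c (q p.2)) - 2 * π * ε ^ 2)))
        ∂(((volume : Measure Plane).restrict A).prod volume) := by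
  classical
  have hQ : ∀ i, MeasurableSet (q ⁻¹' {i}) := fun i => hqm (measurableSet_singleton i)
  have bQ : ∀ i, Bornology.IsBounded (q ⁻¹' {i}) := fun i =>
    isBounded_closedBall.subset (preimage_subset_closedBall_of_dist_le hq i)
  have hE : ∀ i j, MeasurableSet (innerRegion c ε i j \ (q ⁻¹' {i} ∪ q ⁻¹' {j})) := fun i j =>
    (measurableSet_ball.union measurableSet_ball).diff ((hQ i).union (hQ j))
  have hmeas : ∀ i j, Measurable fun ω => if i = j then 0 else
        (Φ ω).toMeasure (q ⁻¹' {i} ∩ A) * (Φ ω).toMeasure (q ⁻¹' {j}) *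
          ({0} : Set ℝ≥0∞).indicator 1
            ((Φ ω).toMeasure (innerRegion c ε i j \ (q ⁻¹' {i} ∪ q ⁻¹' {j}))) := by
    intro i j
    refine Measurable.ite (MeasurableSet.const _) measurable_const ?_
    exact ((hΦ.measurable_toMeasure_apply ((hQ i).inter hA)).mul
      (hΦ.measurable_toMeasure_apply (hQ j))).mul
      ((measurable_one.indicator (measurableSet_singleton 0)).comp
        (hΦ.measurable_toMeasure_apply (hE i j)))
  refine ⟨_, Measurable.tsum fun i => Measurable.tsum fun j => hmeas i j,
    fun ω => (Φ ω).toMeasure_pairs_le_tsum hq A, ?_⟩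
  rw [lintegral_tsum fun i => (Measurable.tsum fun j => hmeas i j).aemeasurable]
  simp_rw [lintegral_tsum fun j => (hmeas _ j).aemeasurable]
  rw [← tsum_tsum_mul_volume_eq_lintegral hqm (fun i j => ENNReal.ofReal (exp (-lam *
        ((2 - gam) * π * dist (c i) (c j) ^ 2 -
          12 * π * ε * dist (c i) (c j) - 2 * π * ε ^ 2)))), ← ENNReal.tsum_mul_left]
  refine ENNReal.tsum_le_tsum fun i => ?_
  rw [← ENNReal.tsum_mul_left]
  refine ENNReal.tsum_le_tsum fun j => ?_
  by_cases hij : i = j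
  · simp [hij]
  simp_rw [if_neg hij]
  have hdisj : Disjoint (q ⁻¹' {i}) (q ⁻¹' {j}) :=
    Disjoint.preimage q (Set.disjoint_singleton.2 hij)
  rw [hΦ.lintegral_mul_mul_void ((hQ i).inter hA) (hQ j) (hE i j)
    ((bQ i).subset Set.inter_subset_left) (bQ j)
    ((isBounded_innerRegion c ε i j).subset Set.sdiff_subset)
    (hdisj.mono_left Set.inter_subset_left)
    (Set.disjoint_sdiff_right.mono_left (Set.inter_subset_left.trans Set.subset_union_left))
    (Set.disjoint_sdiff_right.mono_left Set.subset_union_right)]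
  refine (mul_le_mul' le_rfl (ENNReal.ofReal_le_ofReal (exp_le_exp.2 (mul_le_mul_of_nonpos_left
    (le_volume_innerRegion_diff hε hq i j) (neg_nonpos.2 lam.coe_nonneg))))).trans_eq ?_
  ring

open Classical in
theorem le_lintegral_pairs (hΦ : IsPoissonPointProcess Φ lam P) {q : Plane → ℕ}
    {c : ℕ → Plane} {ε : ℝ} (hε : 0 < ε) (hqm : Measurable q) (hq : ∀ x, dist x (c (q x)) ≤ ε)
    {A : Set Plane} (hA : MeasurableSet A) :
    lam ^ 2 * ∫⁻ p, (if q p.1 = q p.2 then 0 else ENNReal.ofReal (exp (-lam *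
        ((2 - gam) * π * dist (c (q p.1)) (c (q p.2)) ^ 2 +
          12 * π * ε * dist (c (q p.1)) (c (q p.2)) + 18 * π * ε ^ 2))))
        ∂(((volume : Measure Plane).restrict A).prod volume) ≤
      ∫⁻ ω, (Φ ω).pairs.toMeasure A ∂P := by
  have hQ : ∀ i, MeasurableSet (q ⁻¹' {i}) := fun i => hqm (measurableSet_singleton i)
  have bQ : ∀ i, Bornology.IsBounded (q ⁻¹' {i}) := fun i =>
    isBounded_closedBall.subset (preimage_subset_closedBall_of_dist_le hq i)
  have hE : ∀ i j, MeasurableSet (outerRegion c ε i j \ ((q ⁻¹' {i} ∩ A) ∪ q ⁻¹' {j})) :=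
    fun i j => (measurableSet_ball.union measurableSet_ball).diff (((hQ i).inter hA).union (hQ j))
  have hind : ∀ a, Measurable (({a} : Set ℝ≥0∞).indicator (1 : ℝ≥0∞ → ℝ≥0∞)) :=
    fun a => measurable_one.indicator (measurableSet_singleton a)
  have hmeas : ∀ i j, Measurable fun ω => if i = j then 0 else
        ({1} : Set ℝ≥0∞).indicator 1 ((Φ ω).toMeasure (q ⁻¹' {i} ∩ A)) *
        ({1} : Set ℝ≥0∞).indicator 1 ((Φ ω).toMeasure (q ⁻¹' {j})) *
        ({0} : Set ℝ≥0∞).indicator (1 : ℝ≥0∞ → ℝ≥0∞)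
          ((Φ ω).toMeasure (outerRegion c ε i j \ ((q ⁻¹' {i} ∩ A) ∪ q ⁻¹' {j}))) := by
    intro i j
    refine Measurable.ite (MeasurableSet.const _) measurable_const ?_
    exact (((hind 1).comp (hΦ.measurable_toMeasure_apply ((hQ i).inter hA))).mul
      ((hind 1).comp (hΦ.measurable_toMeasure_apply (hQ j)))).mul
      ((hind 0).comp (hΦ.measurable_toMeasure_apply (hE i j)))
  refine le_trans ?_ (lintegral_mono fun ω => (Φ ω).tsum_le_toMeasure_pairs hqm hq hε hA)
  rw [lintegral_tsum fun i => (Measurable.tsum fun j => hmeas i j).aemeasurable]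
  simp_rw [lintegral_tsum fun j => (hmeas _ j).aemeasurable]
  rw [← tsum_tsum_mul_volume_eq_lintegral hqm (fun i j => if i = j then 0 else
        ENNReal.ofReal (exp (-lam * ((2 - gam) * π * dist (c i) (c j) ^ 2 +
          12 * π * ε * dist (c i) (c j) + 18 * π * ε ^ 2)))), ← ENNReal.tsum_mul_left]
  refine ENNReal.tsum_le_tsum fun i => ?_
  rw [← ENNReal.tsum_mul_left]
  refine ENNReal.tsum_le_tsum fun j => ?_
  by_cases hij : i = j
  · simp [hij]
  simp_rw [if_neg hij]
  have hdisj : Disjoint (q ⁻¹' {i}) (q ⁻¹' {j}) :=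
    Disjoint.preimage q (Set.disjoint_singleton.2 hij)
  -- Both cells lie in the outer region, so the union of the three disjoint sets is that region
  -- itself.
  have hsub : (q ⁻¹' {i} ∩ A) ∪ q ⁻¹' {j} ⊆ outerRegion c ε i j := by
    have hd : 0 ≤ dist (c i) (c j) := dist_nonneg
    refine Set.union_subset_union
      (Set.inter_subset_left.trans ((preimage_subset_closedBall_of_dist_le hq i).trans ?_))
      ((preimage_subset_closedBall_of_dist_le hq j).trans ?_) <;>
    exact closedBall_subset_ball (by linarith)
  rw [hΦ.lintegral_one_one_void ((hQ i).inter hA) (hQ j) (hE i j)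
    ((bQ i).subset Set.inter_subset_left) (bQ j)
    ((isBounded_outerRegion c ε i j).subset Set.sdiff_subset)
    (hdisj.mono_left Set.inter_subset_left)
    (Set.disjoint_sdiff_right.mono_left Set.subset_union_left)
    (Set.disjoint_sdiff_right.mono_left Set.subset_union_right), Set.union_sdiff_cancel hsub]
  refine Eq.trans_le ?_ (mul_le_mul' le_rfl (ENNReal.ofReal_le_ofReal (exp_le_exp.2
    (mul_le_mul_of_nonpos_left (volume_outerRegion_le c hε.le i j)
      (neg_nonpos.2 lam.coe_nonneg)))))
  ring

end IsPoissonPointProcess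

end MNN

/-! ### Passage to the limit and the intensity measures -/

namespace MNN

open Metric Real Filter Topology

/-- The plane splits into countably many measurable cells of small diameter. -/
theorem exists_measurable_cells {ε : ℝ} (hε : 0 < ε) :
    ∃ (q : Plane → ℕ) (c : ℕ → Plane), Measurable q ∧ ∀ x, dist x (c (q x)) ≤ ε := by
  classical
  let c : ℕ → Plane := TopologicalSpace.denseSeq Plane
  have h : ∀ x : Plane, ∃ n, dist x (c n) < ε := fun x => by
    obtain ⟨n, hn⟩ := (TopologicalSpace.denseRange_denseSeq Plane).exists_dist_lt x hε
    exact ⟨n, hn⟩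
  refine ⟨fun x => Nat.find (h x), c, measurable_find h fun n => ?_,
    fun x => (Nat.find_spec (h x)).le⟩
  exact measurableSet_lt (by fun_prop) measurable_const

theorem lintegral_exp_neg_mul_dist_sq {b : ℝ} (hb : 0 < b) (A : Set Plane) :
    ∫⁻ p, ENNReal.ofReal (exp (-b * dist p.1 p.2 ^ 2))
      ∂(((volume : Measure Plane).restrict A).prod volume) =
      ENNReal.ofReal (π / b) * volume A := by
  have hint := GaussianFourier.integral_rexp_neg_mul_sq_norm (V := Plane) hb
  have hfin : ((Module.finrank ℝ Plane : ℝ) / 2) = 1 := by simp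
  rw [hfin, rpow_one] at hint
  -- A non-integrable function has integral 0 by convention, whereas this one has positive integral.
  have hI : Integrable fun v : Plane => exp (-b * ‖v‖ ^ 2) := by
    by_contra h
    rw [integral_undef h] at hint
    have := pi_pos
    exact absurd hint (by positivity)
  rw [lintegral_prod _ (by fun_prop)]
  have hx : ∀ x : Plane, ∫⁻ y, ENNReal.ofReal (exp (-b * dist x y ^ 2)) = ENNReal.ofReal (π / b) := by
    intro x
    simp_rw [dist_eq_norm]
    rw [lintegral_sub_left_eq_self (fun v : Plane => ENNReal.ofReal (exp (-b * ‖v‖ ^ 2))) x,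
      ← ofReal_integral_eq_lintegral_ofReal hI (ae_of_all _ fun v => (exp_pos _).le), hint]
  simp_rw [hx]
  rw [lintegral_const, Measure.restrict_apply_univ]

theorem ae_prod_fst_ne_snd (μ : Measure Plane) [SFinite μ] :
    ∀ᵐ p ∂(μ.prod (volume : Measure Plane)), p.1 ≠ p.2 := by
  have hm : MeasurableSet {p : Plane × Plane | p.1 = p.2} :=
    measurableSet_eq_fun measurable_fst measurable_snd
  refine measure_mono_null (t := {p : Plane × Plane | p.1 = p.2}) (fun p hp => ?_) ?_
  · simpa using hp
  · rw [Measure.measure_prod_null hm]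
    refine ae_of_all _ fun x => ?_
    have : Prod.mk x ⁻¹' {p : Plane × Plane | p.1 = p.2} = {x} := by
      ext y; simp [eq_comm]
    change volume (Prod.mk x ⁻¹' {p : Plane × Plane | p.1 = p.2}) = 0
    rw [this, measure_singleton]

theorem abs_dist_sub_dist_le {x y a b : Plane} {ε : ℝ} (hx : dist x a ≤ ε) (hy : dist y b ≤ ε) :
    |dist a b - dist x y| ≤ 2 * ε := by
  have h1 := dist_triangle4 a x y b
  have h2 := dist_triangle4 x a b y
  rw [dist_comm a x] at h1
  rw [dist_comm b y] at h2
  exact abs_le.2 ⟨by linarith, by linarith⟩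

/-- Supplies an ε-free Gaussian majorant for dominated convergence. The constant is 76 = 72 + 2 + 2:
from absorbing 12εd into d²/2, from the term 2ε², and from passing from d to r. -/
theorem quarter_sq_le {r d ε : ℝ} (hr : 0 ≤ r) (hε : 0 ≤ ε) (hε1 : ε ≤ 1)
    (h : |d - r| ≤ 2 * ε) :
    π / 4 * r ^ 2 - 76 * π ≤
      (2 - gam) * π * d ^ 2 - 12 * π * ε * d - 2 * π * ε ^ 2 := by
  obtain ⟨h1, h2⟩ := abs_le.1 h
  have h3 : r ^ 2 ≤ 2 * d ^ 2 + 8 * ε ^ 2 := by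
    have : r ^ 2 ≤ (d + 2 * ε) ^ 2 := by
      have : r ≤ d + 2 * ε := by linarith
      exact pow_le_pow_left₀ hr this 2
    nlinarith [sq_nonneg (d - 2 * ε)]
  have h4 : 12 * ε * d ≤ d ^ 2 / 2 + 72 * ε ^ 2 := by nlinarith [sq_nonneg (d - 12 * ε)]
  have h5 : d ^ 2 ≤ (2 - gam) * d ^ 2 := by nlinarith [gam_le_one, sq_nonneg d]
  have h6 : ε ^ 2 ≤ 1 := by nlinarith
  have h7 : r ^ 2 / 4 - 76 ≤ (2 - gam) * d ^ 2 - 12 * ε * d - 2 * ε ^ 2 := by linarith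
  have := mul_le_mul_of_nonneg_left h7 pi_pos.le
  linarith

namespace Configuration

/-- A bounded set has finitely many atoms, so eventually every paired atom in it is separated from a
partner. -/
theorem toMeasure_pairs_le_liminf (φ : Configuration) {A : Set Plane}
    (bA : Bornology.IsBounded A) {q : ℕ → Plane → ℕ}
    (hq : ∀ x y, x ≠ y → ∀ᶠ n in atTop, q n x ≠ q n y) :
    φ.pairs.toMeasure A ≤
      liminf (fun n => φ.toMeasure (A ∩ {x | ∃ y, φ.MNNR x y ∧ q n x ≠ q n y})) atTop := by
  have hfin : (φ.atoms ∩ A).Finite :=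
    (φ.finite_inter_compact _ bA.isCompact_closure).subset
      (Set.inter_subset_inter_right _ subset_closure)
  have hev : ∀ᶠ n in atTop, ∀ x ∈ φ.atoms ∩ A, φ.IsPaired x →
      ∃ y, φ.MNNR x y ∧ q n x ≠ q n y := by
    rw [Filter.eventually_all_finite hfin]
    intro x _
    by_cases h : φ.IsPaired x
    · obtain ⟨y, -, hxy⟩ := h
      filter_upwards [hq x y (mnnr_iff.1 hxy).2.2.1.symm] with n hn _
      exact ⟨y, hxy, hn⟩
    · exact Eventually.of_forall fun n h' => absurd h' h
  refine le_liminf_of_le (by isBoundedDefault) ?_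
  filter_upwards [hev] with n hn
  rw [pairs, toMeasure_filter, toMeasure_eq_count, toMeasure_eq_count]
  refine measure_mono fun x hx => ?_
  exact ⟨⟨hx.1.1, hn x ⟨hx.2, hx.1.1⟩ hx.1.2⟩, hx.2⟩

end Configuration

variable {Ω : Type*} [MeasurableSpace Ω] {Φ : Ω → Configuration} {lam : ℝ≥0} {P : Measure Ω}

theorem IsPoissonPointProcess.lintegral_pairs (hΦ : IsPoissonPointProcess Φ lam P)
    (hlam : 0 < lam) {A : Set Plane} (hA : MeasurableSet A) (bA : Bornology.IsBounded A) :
    ∫⁻ ω, (Φ ω).pairs.toMeasure A ∂P = ENNReal.ofReal (del * lam) * volume A := by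
  classical
  set μ : Measure (Plane × Plane) := ((volume : Measure Plane).restrict A).prod volume with hμ
  let ε : ℕ → ℝ := fun n => 1 / ((n : ℝ) + 1)
  have hε : ∀ n, 0 < ε n := fun n => by positivity
  have hε1 : ∀ n, ε n ≤ 1 := fun n => by
    rw [div_le_one (by positivity)]; linarith [(Nat.cast_nonneg n : (0 : ℝ) ≤ n)]
  have hε0 : Tendsto ε atTop (𝓝 0) := tendsto_one_div_add_atTop_nhds_zero_nat
  choose q c hqm hq using fun n => exists_measurable_cells (hε n)
  let d : ℕ → Plane × Plane → ℝ := fun n p => dist (c n (q n p.1)) (c n (q n p.2))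
  have hdr : ∀ n p, |d n p - dist p.1 p.2| ≤ 2 * ε n := fun n p =>
    abs_dist_sub_dist_le (hq n p.1) (hq n p.2)
  have hd : ∀ p, Tendsto (fun n => d n p) atTop (𝓝 (dist p.1 p.2)) := by
    intro p
    rw [tendsto_iff_dist_tendsto_zero]
    refine squeeze_zero (fun n => dist_nonneg) (fun n => hdr n p) ?_
    simpa using hε0.const_mul 2
  have hdm : ∀ n, Measurable (d n) := by
    intro n
    have hc : Measurable (c n) := .of_discrete
    exact ((hc.comp (hqm n)).comp measurable_fst).dist ((hc.comp (hqm n)).comp measurable_snd)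
  have hsep : ∀ x y : Plane, x ≠ y → ∀ᶠ n in atTop, q n x ≠ q n y := by
    intro x y hxy
    filter_upwards [(hd (x, y)).eventually_const_lt (dist_pos.2 hxy)] with n hn e
    simp [d, e] at hn
  have hlam' : (0 : ℝ) < lam := hlam
  have hκ : 0 < (2 - gam) * π := mul_pos (by linarith [gam_le_one]) pi_pos
  have hlim := lintegral_exp_neg_mul_dist_sq (mul_pos hlam' hκ) A
  have hval : (lam : ℝ≥0∞) ^ 2 * (ENNReal.ofReal (π / (lam * ((2 - gam) * π))) * volume A) =
      ENNReal.ofReal (del * lam) * volume A := by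
    rw [← mul_assoc, ← ENNReal.ofReal_coe_nnreal, ← ENNReal.ofReal_pow hlam'.le,
      ← ENNReal.ofReal_mul (by positivity)]
    congr 2
    have h1 : 2 - gam ≠ 0 := by linarith [gam_le_one]
    have h2 := pi_ne_zero
    rw [del]
    field_simp
  -- The error coefficients k, l are left free so that the upper and lower bounds share this limit.
  have hexp : ∀ (k l : ℝ) (p : Plane × Plane), Tendsto (fun n => ENNReal.ofReal (exp (-lam *
      ((2 - gam) * π * d n p ^ 2 + k * ε n * d n p + l * ε n ^ 2)))) atTop
      (𝓝 (ENNReal.ofReal (exp (-(lam * ((2 - gam) * π)) * dist p.1 p.2 ^ 2)))) := by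
    intro k l p
    refine (ENNReal.continuous_ofReal.tendsto _).comp ((continuous_exp.tendsto _).comp ?_)
    have := ((((hd p).pow 2).const_mul ((2 - gam) * π)).add
      ((hε0.const_mul k).mul (hd p))).add ((hε0.pow 2).const_mul l)
    convert! this.const_mul (-(lam : ℝ)) using 2
    ring
  have hexpm : ∀ (k l : ℝ) (n : ℕ), Measurable fun p => ENNReal.ofReal (exp (-lam *
      ((2 - gam) * π * d n p ^ 2 + k * ε n * d n p + l * ε n ^ 2))) := by
    intro k l n
    have := hdm n
    fun_prop
  rw [← hval, ← hlim]
  refine le_antisymm ?_ ?_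
  -- Upper bound: Fatou's lemma over Ω, then dominated convergence for the double integrals.
  · choose F hFm hF hFI using fun n =>
      hΦ.lintegral_separated_pairs_le (hε n).le (hqm n) (hq n) hA
    calc ∫⁻ ω, (Φ ω).pairs.toMeasure A ∂P
        ≤ ∫⁻ ω, liminf (fun n => F n ω) atTop ∂P := by
          refine lintegral_mono fun ω => ?_
          exact ((Φ ω).toMeasure_pairs_le_liminf bA hsep).trans
            (liminf_le_liminf (Eventually.of_forall fun n => hF n ω))
      _ ≤ liminf (fun n => ∫⁻ ω, F n ω ∂P) atTop := lintegral_liminf_le hFm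
      _ ≤ liminf (fun n => (lam : ℝ≥0∞) ^ 2 * ∫⁻ p, ENNReal.ofReal (exp (-lam *
          ((2 - gam) * π * d n p ^ 2 + (-(12 * π)) * ε n * d n p + (-(2 * π)) * ε n ^ 2))) ∂μ)
          atTop := by
          refine liminf_le_liminf (Eventually.of_forall fun n => (hFI n).trans_eq ?_)
          simp only [d, hμ, sub_eq_add_neg, neg_mul]
      _ = _ := by
          refine Tendsto.liminf_eq (ENNReal.Tendsto.const_mul ?_ (Or.inr (by simp)))
          refine tendsto_lintegral_of_dominated_convergence (fun p =>
            ENNReal.ofReal (exp (76 * π * lam)) *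
              ENNReal.ofReal (exp (-(π / 4 * lam) * dist p.1 p.2 ^ 2)))
            (fun n => hexpm _ _ n) (fun n => ae_of_all _ fun p => ?_) ?_
            (ae_of_all _ fun p => hexp _ _ p)
          · beta_reduce
            rw [← ENNReal.ofReal_mul (by positivity), ← exp_add]
            refine ENNReal.ofReal_le_ofReal (exp_le_exp.2 ?_)
            have := mul_le_mul_of_nonneg_left
              (quarter_sq_le dist_nonneg (hε n).le (hε1 n) (hdr n p)) hlam'.le
            linarith
          · rw [lintegral_const_mul _ (by fun_prop), lintegral_exp_neg_mul_dist_sq (by positivity)]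
            exact ENNReal.mul_ne_top ENNReal.ofReal_ne_top
              (ENNReal.mul_ne_top ENNReal.ofReal_ne_top bA.measure_lt_top.ne)
  -- Lower bound: Fatou's lemma on the plane squared suffices. The terms set to 0 within a common
  -- cell disappear in the limit off the null diagonal.
  · let g : ℕ → Plane × Plane → ℝ≥0∞ := fun n p => if q n p.1 = q n p.2 then 0 else
      ENNReal.ofReal (exp (-lam * ((2 - gam) * π * d n p ^ 2 + 12 * π * ε n * d n p +
        18 * π * ε n ^ 2)))
    have hgm : ∀ n, Measurable (g n) := fun n =>
      Measurable.ite (measurableSet_eq_fun ((hqm n).comp measurable_fst)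
        ((hqm n).comp measurable_snd)) measurable_const (hexpm _ _ n)
    calc (lam : ℝ≥0∞) ^ 2 *
          ∫⁻ p, ENNReal.ofReal (exp (-(lam * ((2 - gam) * π)) * dist p.1 p.2 ^ 2)) ∂μ
        = lam ^ 2 * ∫⁻ p, liminf (fun n => g n p) atTop ∂μ := by
          congr 1
          refine lintegral_congr_ae ?_
          filter_upwards [ae_prod_fst_ne_snd (volume.restrict A)] with p hp
          refine (Tendsto.liminf_eq ((hexp (12 * π) (18 * π) p).congr' ?_)).symm
          filter_upwards [hsep p.1 p.2 hp] with n hn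
          simp [g, hn]
      _ ≤ lam ^ 2 * liminf (fun n => ∫⁻ p, g n p ∂μ) atTop := by
          gcongr
          exact lintegral_liminf_le hgm
      _ = liminf (fun n => lam ^ 2 * ∫⁻ p, g n p ∂μ) atTop := by
          rw [ENNReal.liminf_const_mul_of_ne_top (by simp)]
      _ ≤ ∫⁻ ω, (Φ ω).pairs.toMeasure A ∂P := by
          refine liminf_le_of_le (by isBoundedDefault) fun b hb => ?_
          obtain ⟨n, hn⟩ := hb.exists
          exact hn.trans (hΦ.le_lintegral_pairs (hε n) (hqm n) (hq n) hA)

theorem measure_ext_of_isBounded {μ ν : Measure Plane}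
    (h : ∀ A, MeasurableSet A → Bornology.IsBounded A → μ A = ν A) : μ = ν := by
  ext A hA
  have hmono : Monotone fun m : ℕ => A ∩ closedBall (0 : Plane) m :=
    fun m n h => Set.inter_subset_inter_right _ (closedBall_subset_closedBall (by exact_mod_cast h))
  have hU : A = ⋃ m : ℕ, A ∩ closedBall (0 : Plane) m := by
    rw [← Set.inter_iUnion, iUnion_closedBall_nat, Set.inter_univ]
  rw [hU, hmono.measure_iUnion, hmono.measure_iUnion]
  exact iSup_congr fun m => h _ (hA.inter isClosed_closedBall.measurableSet)
    (isBounded_closedBall.subset Set.inter_subset_right)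

theorem intensityMeasure_eq_lintegral {Ψ : Ω → Configuration} (hΨ : Measurable Ψ)
    {A : Set Plane} (hA : MeasurableSet A) :
    intensityMeasure Ψ P A = ∫⁻ ω, (Ψ ω).toMeasure A ∂P := by
  simp_rw [intensityMeasure_apply hΨ P hA, Configuration.toMeasure_apply _ hA]

theorem del_nonneg : 0 ≤ del := one_div_nonneg.2 (by linarith [gam_le_one])

theorem del_le_one : del ≤ 1 := by
  rw [del, div_le_one] <;> linarith [gam_le_one]

end MNN

theorem corollary1 {Ω : Type*} [MeasurableSpace Ω] (P : Measure Ω) [IsProbabilityMeasure P]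
    (lam : ℝ≥0) (hlam : 0 < lam) (Φ : Ω → MNN.Configuration)
    (hΦ : MNN.IsPoissonPointProcess Φ lam P) :
    (Measurable (fun ω => (Φ ω).singles) ∧ Measurable (fun ω => (Φ ω).pairs)) ∧
    MNN.intensityMeasure (fun ω => (Φ ω).singles) P =
      ENNReal.ofReal ((1 - MNN.del) * lam) • (volume : Measure MNN.Plane) ∧
    MNN.intensityMeasure (fun ω => (Φ ω).pairs) P =
      ENNReal.ofReal (MNN.del * lam) • (volume : Measure MNN.Plane) := by
  have hs : Measurable fun ω => (Φ ω).singles :=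
    MNN.Configuration.measurable_singles.comp hΦ.measurable
  have hp : Measurable fun ω => (Φ ω).pairs :=
    MNN.Configuration.measurable_pairs.comp hΦ.measurable
  refine ⟨⟨hs, hp⟩, MNN.measure_ext_of_isBounded fun A hA bA => ?_,
    MNN.measure_ext_of_isBounded fun A hA bA => ?_⟩
  · have hsum : ∫⁻ ω, (Φ ω).singles.toMeasure A ∂P + ∫⁻ ω, (Φ ω).pairs.toMeasure A ∂P =
        lam * volume A := by
      rw [← hΦ.lintegral_toMeasure hA bA, ← lintegral_add_right]
      · simp_rw [MNN.Configuration.toMeasure_singles_add_pairs _ hA]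
      · exact (Measure.measurable_coe hA).comp (MNN.Configuration.measurable_toMeasure.comp hp)
    -- Finiteness on bounded sets permits cancelling the paired part from the total in `ℝ≥0∞`.
    have hfin : ENNReal.ofReal (MNN.del * lam) * volume A ≠ ∞ :=
      ENNReal.mul_ne_top ENNReal.ofReal_ne_top bA.measure_lt_top.ne
    have h1 : 0 ≤ (1 - MNN.del) * lam := mul_nonneg (by linarith [MNN.del_le_one]) lam.coe_nonneg
    have h2 : 0 ≤ MNN.del * lam := mul_nonneg MNN.del_nonneg lam.coe_nonneg
    rw [hΦ.lintegral_pairs hlam hA bA] at hsum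
    rw [MNN.intensityMeasure_eq_lintegral hs hA, Measure.smul_apply, smul_eq_mul,
      ← ENNReal.add_left_inj hfin, hsum, ← add_mul, ← ENNReal.ofReal_add h1 h2, ← add_mul,
      sub_add_cancel, one_mul, ENNReal.ofReal_coe_nnreal]
  · rw [MNN.intensityMeasure_eq_lintegral hp hA, hΦ.lintegral_pairs hlam hA bA,
      Measure.smul_apply, smul_eq_mul]
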